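/- For $0<\alpha\le 2$ let $f_\alpha$ be the (continuous) probability density function of the symmetric $\alpha$-stable law with characteristic function $\omega\mapsto e^{-|\omega|^\alpha/\alpha}$, and let $h_\alpha=-\int_{\mathbb R} f_\alpha\log f_\alpha$ be its differential entropy. For a real random variable $Y$ define its strength $$s_\alpha(Y)=\inf\{s>0:\ -\mathbb E[\log f_\alpha(Y/s)]\le h_\alpha\},$$ and say that $s_\alpha(Y)$ exists if this set is nonempty. Let $0<\alpha\le 2$ and let $X$ be a real random variable that has a probability density function and whose strength $s_\alpha(X)$ exists. For $\Delta>0$ let $\hat X_\Delta$ be the uniformly quantized version of $X$: $\hat X_\Delta=k\Delta$ whenever $X\in(k\Delta-\Delta/2,\,k\Delta+\Delta/2]$, $k\in\mathbb Z$. Let $U$ be uniformly distributed on $(-1/2,1/2)$. Then $s_\alpha(U)$ and $s_\alpha(X-\hat X_\Delta)$, for every $\Delta>0$, exist, and $$\frac{s_\alpha(X-\hat X_\Delta)}{\Delta}\longrightarrow s_\alpha(U)\qquad\text{as }\Delta\to 0^+ .$$ Moreover, $s_2(U)=\sqrt{1/12}$. -/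

import Mathlib

open MeasureTheory ProbabilityTheory Filter Topology

noncomputable section

/-- Characteristic function `ω ↦ exp (-γ^α |ω|^α)` of the symmetric `α`-stable law `S(α, γ)`. -/
def sasCharFun (α γ ω : ℝ) : ℝ :=
  Real.exp (-(γ ^ α * |ω| ^ α))

/-- The (continuous) probability density function of `S(α, γ)`: the characteristic function is
integrable for `α, γ > 0`, so the density is given everywhere by the Fourier inversion formula
`f(x) = (2π)⁻¹ ∫ e^{-iωx} φ(ω) dω`. -/
def sasDensity (α γ x : ℝ) : ℝ :=
  (2 * Real.pi)⁻¹ *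
    (∫ ω : ℝ, Complex.exp (-((ω : ℂ) * (x : ℂ) * Complex.I)) * (sasCharFun α γ ω : ℂ)).re

/-- Density of the reference variable `Z̃_α ∼ S(α, (1/α)^(1/α))`. -/
def refDensity (α x : ℝ) : ℝ :=
  sasDensity α ((1 / α) ^ (1 / α)) x

/-- Differential entropy `h(Z̃_α)` of the reference variable. -/
def refEntropy (α : ℝ) : ℝ :=
  -∫ x : ℝ, refDensity α x * Real.log (refDensity α x)

/-- The levels `s > 0` with `-E[log f_{Z̃_α}(Y / s)] ≤ h(Z̃_α)`, the expectation being finite. Since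
`-log f_{Z̃_α}` is bounded below, the expectation is `+∞` when the integrand is not integrable, and
the inequality then fails. -/
def strengthSet {Ω : Type*} [MeasurableSpace Ω] (α : ℝ) (Y : Ω → ℝ) (P : Measure Ω) : Set ℝ :=
  {s : ℝ | 0 < s ∧ Integrable (fun w => Real.log (refDensity α (Y w / s))) P ∧
    -(∫ w, Real.log (refDensity α (Y w / s)) ∂P) ≤ refEntropy α}

/-- The strength of `Y` exists: the infimum defining it is over a nonempty set. -/
def StrengthExists {Ω : Type*} [MeasurableSpace Ω] (α : ℝ) (Y : Ω → ℝ) (P : Measure Ω) : Prop :=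
  (strengthSet α Y P).Nonempty

/-- The strength (`α`-power) `s_α(Y)` of a real random variable `Y`. -/
def strength {Ω : Type*} [MeasurableSpace Ω] (α : ℝ) (Y : Ω → ℝ) (P : Measure Ω) : ℝ :=
  sInf (strengthSet α Y P)

/-- The uniform quantizer with step `Δ > 0`, which sends the cell `(kΔ - Δ/2, kΔ + Δ/2]` to `kΔ`. -/
def uniformQuantizer (Δ x : ℝ) : ℝ :=
  (⌈x / Δ - 1 / 2⌉ : ℤ) * Δ

theorem uniformQuantizer_eq {Δ : ℝ} (hΔ : 0 < Δ) (k : ℤ) {x : ℝ}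
    (hx : x ∈ Set.Ioc (k * Δ - Δ / 2) (k * Δ + Δ / 2)) : uniformQuantizer Δ x = k * Δ := by
  obtain ⟨h1, h2⟩ := hx
  have h : ⌈x / Δ - 1 / 2⌉ = k := by
    rw [Int.ceil_eq_iff]
    constructor
    · have : (k : ℝ) - 1 / 2 < x / Δ := by rw [lt_div_iff₀ hΔ]; linarith
      linarith
    · have : x / Δ ≤ (k : ℝ) + 1 / 2 := by rw [div_le_iff₀ hΔ]; linarith
      linarith
  rw [uniformQuantizer, h]

end

/-!
The characteristic function `exp (-a |ω| ^ (2 β))`, `β ≤ 1`, is the limit of the `n`-th powers of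
`1 - (1 - x) ^ β` evaluated at Gaussians `x = exp (-δ ω ^ 2)`, and that function of `x` has a power
series with nonnegative coefficients. Hence the stable density is a limit of Gaussian mixtures: it
is positive, even and unimodal, and log-convexity in `x ^ 2` makes it strictly decreasing in `|x|`.

By the Riemann–Lebesgue lemma and Weyl's criterion, `X / Δ` equidistributes modulo one, so
the cost `-E log f(· / t)` of the normalized quantization error tends to that of `U` for each level
`t`. The cost of a nonzero variable is strictly decreasing in the level, and that of the zero
variable stays below the entropy; therefore convergence of costs forces convergence of the
strengths. For `α = 2` the cost is quadratic and the strength is the root mean square.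
-/

/-- Properties shared by all mixtures of centred Gaussian densities: nonnegativity, symmetric
unimodality and midpoint log-convexity in the variable `x ^ 2`. -/
structure IsGaussianMixtureLike (F : ℝ → ℝ) : Prop where
  nonneg : ∀ x, 0 ≤ F x
  anti : ∀ x y, |x| ≤ |y| → F y ≤ F x
  logConvex : ∀ x y z, x ^ 2 + y ^ 2 = 2 * z ^ 2 → F z ^ 2 ≤ F x * F y

namespace IsGaussianMixtureLike

variable {F G : ℝ → ℝ}

theorem gaussian {c b : ℝ} (hc : 0 ≤ c) (hb : 0 ≤ b) :
    IsGaussianMixtureLike fun x => c * Real.exp (-(b * x ^ 2)) where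
  nonneg x := by positivity
  anti x y h := by
    have := sq_le_sq.2 h
    gcongr
  logConvex x y z h := by
    have hexp : Real.exp (-(b * z ^ 2)) ^ 2 =
        Real.exp (-(b * x ^ 2)) * Real.exp (-(b * y ^ 2)) := by
      rw [← Real.exp_add, ← Real.exp_nat_mul]
      congr 1
      push_cast
      linear_combination b * h
    exact le_of_eq (by linear_combination c ^ 2 * hexp)

theorem zero : IsGaussianMixtureLike fun _ => 0 where
  nonneg _ := le_rfl
  anti _ _ _ := le_rfl
  logConvex _ _ _ _ := by simp

theorem add (hF : IsGaussianMixtureLike F) (hG : IsGaussianMixtureLike G) :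
    IsGaussianMixtureLike fun x => F x + G x where
  nonneg x := add_nonneg (hF.nonneg x) (hG.nonneg x)
  anti x y h := add_le_add (hF.anti x y h) (hG.anti x y h)
  logConvex x y z h := by
    have hFz := hF.logConvex x y z h
    have hGz := hG.logConvex x y z h
    have hFx := hF.nonneg x
    have hFy := hF.nonneg y
    have hGx := hG.nonneg x
    have hGy := hG.nonneg y
    have hcross : 2 * (F z * G z) ≤ F x * G y + G x * F y := by
      refine (abs_le_of_sq_le_sq' ?_ (by positivity)).2
      have : (F z * G z) ^ 2 ≤ (F x * F y) * (G x * G y) := by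
        rw [mul_pow]
        exact mul_le_mul hFz hGz (sq_nonneg _) (mul_nonneg hFx hFy)
      nlinarith [sq_nonneg (F x * G y - G x * F y)]
    linarith

theorem const_mul (hF : IsGaussianMixtureLike F) {c : ℝ} (hc : 0 ≤ c) :
    IsGaussianMixtureLike fun x => c * F x where
  nonneg x := mul_nonneg hc (hF.nonneg x)
  anti x y h := mul_le_mul_of_nonneg_left (hF.anti x y h) hc
  logConvex x y z h := by
    have := mul_le_mul_of_nonneg_left (hF.logConvex x y z h) (sq_nonneg c)
    linarith

theorem of_tendsto {ι : Type*} {l : Filter ι} [l.NeBot] {F : ι → ℝ → ℝ} {G : ℝ → ℝ}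
    (hF : ∀ i, IsGaussianMixtureLike (F i)) (h : ∀ x, Tendsto (fun i => F i x) l (𝓝 (G x))) :
    IsGaussianMixtureLike G where
  nonneg x := ge_of_tendsto' (h x) fun i => (hF i).nonneg x
  anti x y hxy := le_of_tendsto_of_tendsto' (h y) (h x) fun i => (hF i).anti x y hxy
  logConvex x y z hz := le_of_tendsto_of_tendsto' ((h z).pow 2) ((h x).mul (h y))
    fun i => (hF i).logConvex x y z hz

theorem even (hF : IsGaussianMixtureLike F) (x : ℝ) : F (-x) = F x :=
  le_antisymm (hF.anti _ _ (by simp)) (hF.anti _ _ (by simp))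

-- By log-convexity a zero at `x` propagates to `(√2)⁻¹ ^ n * x`, hence to `0`.
theorem pos (hF : IsGaussianMixtureLike F) (hc : ContinuousAt F 0) (h0 : F 0 ≠ 0) (x : ℝ) :
    0 < F x := by
  refine lt_of_le_of_ne (hF.nonneg x) fun hx => h0 ?_
  have hcontract : ∀ y, F y = 0 → F ((√2)⁻¹ * y) = 0 := by
    intro y hy
    have := hF.logConvex 0 y ((√2)⁻¹ * y) (by
      rw [mul_pow, inv_pow, Real.sq_sqrt zero_le_two]; ring)
    rw [hy, mul_zero] at this
    exact pow_eq_zero_iff two_ne_zero |>.1 (le_antisymm this (sq_nonneg _))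
  have hzero : ∀ n : ℕ, F ((√2)⁻¹ ^ n * x) = 0 := by
    intro n
    induction n with
    | zero => simpa using hx.symm
    | succ n ih => rw [pow_succ', mul_assoc]; exact hcontract _ ih
  have hlim : Tendsto (fun n : ℕ => (√2)⁻¹ ^ n * x) atTop (𝓝 0) := by
    simpa using (tendsto_pow_atTop_nhds_zero_of_lt_one (r := (√2)⁻¹) (by positivity)
      (inv_lt_one_of_one_lt₀ (by rw [Real.lt_sqrt] <;> norm_num))).mul_const x
  have hF0 := hc.tendsto.comp hlim
  simp only [Function.comp_def, hzero] at hF0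
  exact tendsto_nhds_unique hF0 tendsto_const_nhds

-- Were `F x = F y`, log-convexity would make `F` at least `F x` at all points `w n`, which tend
-- to infinity.
theorem apply_lt_of_abs_lt (hF : IsGaussianMixtureLike F) (hpos : ∀ x, 0 < F x)
    (hlim : Tendsto F atTop (𝓝 0)) {x y : ℝ} (hxy : |x| < |y|) : F y < F x := by
  by_contra! hle
  have hsq : 0 < y ^ 2 - x ^ 2 := sub_pos.2 (sq_lt_sq.2 hxy)
  let w (n : ℕ) : ℝ := √(x ^ 2 + 2 ^ n * (y ^ 2 - x ^ 2))
  have hw_sq (n : ℕ) : w n ^ 2 = x ^ 2 + 2 ^ n * (y ^ 2 - x ^ 2) :=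
    Real.sq_sqrt (by positivity)
  have hw_le : ∀ n, F x ≤ F (w n) := by
    intro n
    induction n with
    | zero => exact hle.trans (hF.anti _ _ (sq_le_sq.1 (by rw [hw_sq]; simp)))
    | succ n ih =>
      have hconv : F (w n) ^ 2 ≤ F x * F (w (n + 1)) :=
        hF.logConvex _ _ _ (by rw [hw_sq, hw_sq]; ring)
      have hsq_le : F x ^ 2 ≤ F (w n) ^ 2 := pow_le_pow_left₀ (hpos x).le ih 2
      exact le_of_mul_le_mul_left ((sq (F x)).symm.le.trans (hsq_le.trans hconv)) (hpos x)
  have hw_lim : Tendsto w atTop atTop :=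
    Real.tendsto_sqrt_atTop.comp (tendsto_atTop_add_const_left _ _
      ((tendsto_pow_atTop_atTop_of_one_lt one_lt_two).atTop_mul_const hsq))
  exact (hpos x).not_ge (ge_of_tendsto' (hlim.comp hw_lim) hw_le)

end IsGaussianMixtureLike

/-- The cosine transform `x ↦ ∫ cos (ω x) ψ(ω) dω`, that is, the unnormalized Fourier transform of
an even function kept real-valued. -/
noncomputable def cosTransform (ψ : ℝ → ℝ) (x : ℝ) : ℝ := ∫ ω : ℝ, Real.cos (ω * x) * ψ ω

section CosTransform

variable {ψ g : ℝ → ℝ}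

theorem abs_cos_mul_le (x ω : ℝ) : |Real.cos (ω * x) * ψ ω| ≤ |ψ ω| := by
  rw [abs_mul]
  exact mul_le_of_le_one_left (abs_nonneg _) (Real.abs_cos_le_one _)

theorem integrable_cos_mul (hψ : Integrable ψ) (x : ℝ) :
    Integrable fun ω : ℝ => Real.cos (ω * x) * ψ ω :=
  hψ.bdd_mul (c := 1) (by fun_prop) (ae_of_all _ fun ω => Real.abs_cos_le_one (ω * x))

theorem abs_cosTransform_le (hψ : Integrable ψ) (x : ℝ) : |cosTransform ψ x| ≤ ∫ ω, |ψ ω| :=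
  abs_integral_le_integral_abs.trans
    (integral_mono (integrable_cos_mul hψ x).abs hψ.abs (abs_cos_mul_le x))

theorem continuous_cosTransform (hψ : Integrable ψ) : Continuous (cosTransform ψ) :=
  continuous_of_dominated (bound := fun ω => |ψ ω|)
    (fun x => (integrable_cos_mul hψ x).aestronglyMeasurable)
    (fun x => ae_of_all _ (abs_cos_mul_le x)) hψ.abs (ae_of_all _ fun ω => by fun_prop)

theorem tendsto_cosTransform {ψ : ℕ → ℝ → ℝ} {φ B : ℝ → ℝ} (hm : ∀ n, AEStronglyMeasurable (ψ n))
    (hB : Integrable B) (hle : ∀ n, ∀ᵐ ω, |ψ n ω| ≤ B ω)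
    (hlim : ∀ᵐ ω, Tendsto (fun n => ψ n ω) atTop (𝓝 (φ ω))) (x : ℝ) :
    Tendsto (fun n => cosTransform (ψ n) x) atTop (𝓝 (cosTransform φ x)) := by
  refine tendsto_integral_of_dominated_convergence B
    (fun n => (by fun_prop : Continuous fun ω : ℝ => Real.cos (ω * x)).aestronglyMeasurable.mul
      (hm n)) hB (fun n => ?_) ?_
  · filter_upwards [hle n] with ω hω using (abs_cos_mul_le x ω).trans hω
  · filter_upwards [hlim] with ω hω using hω.const_mul _

theorem cosTransform_add (hψ : Integrable ψ) (hg : Integrable g) (x : ℝ) :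
    cosTransform (fun ω => ψ ω + g ω) x = cosTransform ψ x + cosTransform g x := by
  simp only [cosTransform, mul_add]
  exact integral_add (integrable_cos_mul hψ x) (integrable_cos_mul hg x)

theorem cosTransform_const_mul (c : ℝ) (ψ : ℝ → ℝ) (x : ℝ) :
    cosTransform (fun ω => c * ψ ω) x = c * cosTransform ψ x := by
  simp only [cosTransform, mul_left_comm _ c, integral_const_mul]

theorem cosTransform_neg (ψ : ℝ → ℝ) (x : ℝ) : cosTransform ψ (-x) = cosTransform ψ x := by
  simp only [cosTransform, mul_neg, Real.cos_neg]

theorem integral_eq_zero_of_odd {f : ℝ → ℝ} (hf : ∀ x, f (-x) = -f x) : ∫ x, f x = 0 := by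
  have h := integral_neg_eq_self f volume
  simp only [hf, integral_neg] at h
  linarith

theorem ofReal_cosTransform (hψ : Integrable ψ) (heven : ∀ ω, ψ (-ω) = ψ ω) (x : ℝ) :
    ((cosTransform ψ x : ℝ) : ℂ) = ∫ ω : ℝ, Complex.exp (ω * x * Complex.I) * ψ ω := by
  have hint : Integrable fun ω : ℝ => Complex.exp (ω * x * Complex.I) * ψ ω := by
    refine hψ.ofReal.bdd_mul (c := 1) (by fun_prop) (ae_of_all _ fun ω => ?_)
    rw [← Complex.ofReal_mul, Complex.norm_exp_ofReal_mul_I]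
  have hre := integral_re hint
  have him := integral_im hint
  simp only [RCLike.re_to_complex, RCLike.im_to_complex, Complex.re_mul_ofReal,
    Complex.im_mul_ofReal, ← Complex.ofReal_mul, Complex.exp_ofReal_mul_I_re,
    Complex.exp_ofReal_mul_I_im] at hre him
  have hsin : ∫ ω : ℝ, Real.sin (ω * x) * ψ ω = 0 :=
    integral_eq_zero_of_odd fun ω => by rw [heven, neg_mul, Real.sin_neg, neg_mul]
  refine Complex.ext ?_ ?_
  · simpa only [Complex.ofReal_re, Complex.ofReal_mul, cosTransform] using hre
  · simpa only [Complex.ofReal_im, Complex.ofReal_mul, hsin] using him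

theorem cosTransform_gaussian {b : ℝ} (hb : 0 < b) (x : ℝ) :
    cosTransform (fun ω => Real.exp (-(b * ω ^ 2))) x =
      √(Real.pi / b) * Real.exp (-((4 * b)⁻¹ * x ^ 2)) := by
  have hint : Integrable fun ω : ℝ => Real.exp (-(b * ω ^ 2)) := by
    simpa only [neg_mul] using integrable_exp_neg_mul_sq hb
  have hfourier := fourierIntegral_gaussian (b := (b : ℂ)) (by simpa using hb) x
  rw [← Complex.ofReal_inj, ofReal_cosTransform hint (by simp), Real.sqrt_eq_rpow]
  push_cast [Complex.ofReal_cpow (div_pos Real.pi_pos hb).le]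
  refine (integral_congr_ae (ae_of_all _ fun ω => ?_)).trans (hfourier.trans ?_)
  · simp only [neg_mul]
    ring_nf
  · congr 2
    ring

theorem integrable_cosTransform_gaussian {b : ℝ} (hb : 0 < b) :
    Integrable (cosTransform fun ω => Real.exp (-(b * ω ^ 2))) := by
  rw [funext (cosTransform_gaussian hb)]
  simp only [← neg_mul]
  exact (integrable_exp_neg_mul_sq (by positivity)).const_mul _

theorem integral_cosTransform_gaussian {b : ℝ} (hb : 0 < b) :
    ∫ x, cosTransform (fun ω => Real.exp (-(b * ω ^ 2))) x = 2 * Real.pi := by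
  simp only [cosTransform_gaussian hb]
  simp only [← neg_mul]
  rw [integral_const_mul, integral_gaussian, ← Real.sqrt_mul (by positivity),
    show Real.pi / b * (Real.pi / (4 * b)⁻¹) = (2 * Real.pi) ^ 2 by field_simp; ring,
    Real.sqrt_sq (by positivity)]

theorem integral_cosTransform_mul (hψ : Integrable ψ) (hg : Integrable g) :
    ∫ x, cosTransform ψ x * g x = ∫ ω, ψ ω * cosTransform g ω := by
  have hprod : Integrable (Function.uncurry fun x ω : ℝ => Real.cos (ω * x) * ψ ω * g x)
      (volume.prod volume) := by
    refine ((hg.mul_prod hψ).bdd_mul (c := 1) (f := fun p : ℝ × ℝ => Real.cos (p.2 * p.1))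
      (by fun_prop) (ae_of_all _ fun p => Real.abs_cos_le_one _)).congr (ae_of_all _ fun p => ?_)
    simp only [Function.uncurry]
    ring
  calc ∫ x, cosTransform ψ x * g x
      = ∫ x, ∫ ω, Real.cos (ω * x) * ψ ω * g x := by simp only [cosTransform, integral_mul_const]
    _ = ∫ ω, ∫ x, Real.cos (ω * x) * ψ ω * g x := integral_integral_swap hprod
    _ = ∫ ω, ψ ω * cosTransform g ω := by
        simp only [cosTransform, ← integral_const_mul]
        congr! 3 with ω
        ext x
        rw [mul_comm ω x]
        ring

theorem integral_cosTransform_mul_gaussian_le (hψ : Integrable ψ) {M : ℝ} (hM : ∀ ω, ψ ω ≤ M)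
    {b : ℝ} (hb : 0 < b) :
    ∫ x, cosTransform ψ x * Real.exp (-(b * x ^ 2)) ≤ 2 * Real.pi * M := by
  have hgi : Integrable fun x : ℝ => Real.exp (-(b * x ^ 2)) := by
    simpa only [neg_mul] using integrable_exp_neg_mul_sq hb
  have hnn : ∀ ω, 0 ≤ cosTransform (fun x => Real.exp (-(b * x ^ 2))) ω := fun ω => by
    rw [cosTransform_gaussian hb]
    positivity
  have htransform := integrable_cosTransform_gaussian hb
  calc ∫ x, cosTransform ψ x * Real.exp (-(b * x ^ 2))
      = ∫ ω, ψ ω * cosTransform (fun x => Real.exp (-(b * x ^ 2))) ω :=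
        integral_cosTransform_mul hψ hgi
    _ ≤ ∫ ω, M * cosTransform (fun x => Real.exp (-(b * x ^ 2))) ω :=
        integral_mono (hψ.mul_bdd (continuous_cosTransform hgi).aestronglyMeasurable
          (ae_of_all _ (abs_cosTransform_le hgi))) (htransform.const_mul M)
          fun ω => mul_le_mul_of_nonneg_right (hM ω) (hnn ω)
    _ = 2 * Real.pi * M := by
        rw [integral_const_mul, integral_cosTransform_gaussian hb, mul_comm]

theorem intervalIntegral_cosTransform_le (hψ : Integrable ψ) {M : ℝ} (hM : ∀ ω, ψ ω ≤ M)
    (hnn : ∀ x, 0 ≤ cosTransform ψ x) {R : ℝ} (hR : 0 < R) :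
    ∫ x in -R..R, cosTransform ψ x ≤ Real.exp 1 * (2 * Real.pi * M) := by
  have hb : 0 < (R ^ 2)⁻¹ := by positivity
  have hgi : Integrable fun x : ℝ => Real.exp (-((R ^ 2)⁻¹ * x ^ 2)) := by
    simpa only [neg_mul] using integrable_exp_neg_mul_sq hb
  have hFg : Integrable fun x => cosTransform ψ x * Real.exp (-((R ^ 2)⁻¹ * x ^ 2)) :=
    hgi.bdd_mul (continuous_cosTransform hψ).aestronglyMeasurable
      (ae_of_all _ (abs_cosTransform_le hψ))
  have hle : ∀ x ∈ Set.Ioc (-R) R, cosTransform ψ x ≤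
      Real.exp 1 * (cosTransform ψ x * Real.exp (-((R ^ 2)⁻¹ * x ^ 2))) := by
    intro x hx
    rw [mul_left_comm, ← Real.exp_add]
    refine le_mul_of_one_le_right (hnn x) (Real.one_le_exp ?_)
    have : x ^ 2 ≤ R ^ 2 := sq_le_sq' hx.1.le hx.2
    have : (R ^ 2)⁻¹ * x ^ 2 ≤ 1 := inv_mul_le_one_of_le₀ this (by positivity)
    linarith
  rw [intervalIntegral.integral_of_le (by linarith)]
  calc ∫ x in Set.Ioc (-R) R, cosTransform ψ x
      ≤ ∫ x in Set.Ioc (-R) R,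
          Real.exp 1 * (cosTransform ψ x * Real.exp (-((R ^ 2)⁻¹ * x ^ 2))) :=
        setIntegral_mono_on ((continuous_cosTransform hψ).integrableOn_Ioc)
          (hFg.const_mul _).integrableOn measurableSet_Ioc hle
    _ ≤ ∫ x, Real.exp 1 * (cosTransform ψ x * Real.exp (-((R ^ 2)⁻¹ * x ^ 2))) :=
        setIntegral_le_integral (hFg.const_mul _) (ae_of_all _ fun x => by
          have := hnn x
          positivity)
    _ ≤ Real.exp 1 * (2 * Real.pi * M) := by
        rw [integral_const_mul]
        gcongr
        exact integral_cosTransform_mul_gaussian_le hψ hM hb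

theorem integrable_cosTransform_of_nonneg (hψ : Integrable ψ) {M : ℝ} (hM : ∀ ω, ψ ω ≤ M)
    (hnn : ∀ x, 0 ≤ cosTransform ψ x) : Integrable (cosTransform ψ) := by
  refine integrable_of_intervalIntegral_norm_bounded (Real.exp 1 * (2 * Real.pi * M))
    (fun R => (continuous_cosTransform hψ).integrableOn_Ioc) tendsto_neg_atTop_atBot tendsto_id ?_
  filter_upwards [eventually_gt_atTop 0] with R hR
  simp only [Real.norm_of_nonneg (hnn _)]
  exact intervalIntegral_cosTransform_le hψ hM hnn hR

open FourierTransform in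
theorem fourier_ofReal_eq_cosTransform (hψ : Integrable ψ) (heven : ∀ ω, ψ (-ω) = ψ ω) (w : ℝ) :
    𝓕 (fun ω => (ψ ω : ℂ)) w = cosTransform ψ (2 * Real.pi * w) := by
  rw [← cosTransform_neg, ofReal_cosTransform hψ heven, Real.fourier_real_eq_integral_exp_smul]
  congr! 2 with ω
  rw [smul_eq_mul]
  push_cast
  ring_nf

open FourierTransform in
theorem cosTransform_cosTransform (hψ : Integrable ψ) (hc : Continuous ψ)
    (heven : ∀ ω, ψ (-ω) = ψ ω) (hF : Integrable (cosTransform ψ)) (x : ℝ) :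
    cosTransform (cosTransform ψ) x = 2 * Real.pi * ψ x := by
  have hpi : 2 * Real.pi ≠ 0 := by positivity
  have hfourier := funext (fourier_ofReal_eq_cosTransform hψ heven)
  have hinv := congrFun ((Complex.continuous_ofReal.comp hc).fourierInv_fourier_eq hψ.ofReal (by
    simp only [Function.comp_def, hfourier]
    exact (hF.comp_mul_left' hpi).ofReal)) x
  simp only [Function.comp_def, hfourier] at hinv
  rw [Real.fourierInv_eq_fourier_neg, fourier_ofReal_eq_cosTransform
    (ψ := fun ω => cosTransform ψ (2 * Real.pi * ω)) (hF.comp_mul_left' hpi)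
    fun ω => by rw [mul_neg, cosTransform_neg]] at hinv
  rw [← Complex.ofReal_inj.1 hinv, mul_neg, cosTransform_neg, cosTransform, cosTransform]
  have hscale := Measure.integral_comp_mul_left
    (fun ω => Real.cos (ω * x) * cosTransform ψ ω) (2 * Real.pi)
  rw [smul_eq_mul, abs_of_pos (by positivity)] at hscale
  rw [← mul_inv_cancel_left₀ hpi (∫ ω, Real.cos (ω * x) * cosTransform ψ ω), ← hscale]
  congr! 5 with ω
  ring

end CosTransform

/-- Finite sums of nonnegative multiples of integrable centred Gaussians: the functions whose cosine
transform is visibly a finite Gaussian mixture. -/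
inductive IsGaussianSum : (ℝ → ℝ) → Prop
  | zero : IsGaussianSum fun _ => 0
  | gaussian {c b : ℝ} (hc : 0 ≤ c) (hb : 0 < b) :
      IsGaussianSum fun ω => c * Real.exp (-(b * ω ^ 2))
  | add {f g : ℝ → ℝ} : IsGaussianSum f → IsGaussianSum g → IsGaussianSum fun ω => f ω + g ω

namespace IsGaussianSum

variable {f g : ℝ → ℝ}

theorem mul (hf : IsGaussianSum f) (hg : IsGaussianSum g) : IsGaussianSum fun ω => f ω * g ω := by
  induction hf with
  | zero => simpa using IsGaussianSum.zero
  | @gaussian c b hc hb =>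
    induction hg with
    | zero => simpa using IsGaussianSum.zero
    | @gaussian c' b' hc' hb' =>
      convert IsGaussianSum.gaussian (mul_nonneg hc hc') (add_pos hb hb') using 2 with ω
      rw [add_mul, neg_add, Real.exp_add]
      ring
    | add _ _ h₁ h₂ => simpa only [mul_add] using h₁.add h₂
  | add _ _ h₁ h₂ => simpa only [add_mul] using h₁.add h₂

theorem pow (hf : IsGaussianSum f) {n : ℕ} (hn : n ≠ 0) : IsGaussianSum fun ω => f ω ^ n := by
  induction n with
  | zero => contradiction
  | succ n ih =>
    rcases eq_or_ne n 0 with rfl | hn0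
    · simpa using hf
    · simpa only [pow_succ] using (ih hn0).mul hf

theorem integrable (hf : IsGaussianSum f) : Integrable f := by
  induction hf with
  | zero => exact integrable_zero _ _ _
  | gaussian _ hb => simpa using (integrable_exp_neg_mul_sq hb).const_mul _
  | add _ _ h₁ h₂ => exact h₁.add h₂

theorem isGaussianMixtureLike_cosTransform (hf : IsGaussianSum f) :
    IsGaussianMixtureLike (cosTransform f) := by
  induction hf with
  | zero =>
    rw [show cosTransform (fun _ => 0) = fun _ => 0 from funext fun x => by simp [cosTransform]]
    exact .zero
  | @gaussian c b hc hb =>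
    simp only [funext (cosTransform_const_mul c _), cosTransform_gaussian hb]
    exact (IsGaussianMixtureLike.gaussian (by positivity) (by positivity)).const_mul hc
  | add hf hg h₁ h₂ =>
    rw [funext (cosTransform_add hf.integrable hg.integrable)]
    exact h₁.add h₂

end IsGaussianSum

theorem isGaussianMixtureLike_cosTransform_of_tendsto {ψ : ℕ → ℝ → ℝ} {φ B : ℝ → ℝ}
    (hmix : ∀ n, IsGaussianMixtureLike (cosTransform (ψ n)))
    (hm : ∀ n, AEStronglyMeasurable (ψ n)) (hB : Integrable B) (hle : ∀ n, ∀ᵐ ω, |ψ n ω| ≤ B ω)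
    (hlim : ∀ᵐ ω, Tendsto (fun n => ψ n ω) atTop (𝓝 (φ ω))) :
    IsGaussianMixtureLike (cosTransform φ) :=
  .of_tendsto hmix (tendsto_cosTransform hm hB hle hlim)

/-- The generating function `x ↦ 1 - (1 - x) ^ β` of the Sibuya law, whose power series has
nonnegative coefficients for `0 ≤ β ≤ 1`. -/
noncomputable def sibuyaGen (β x : ℝ) : ℝ := 1 - (1 - x) ^ β

/-- The coefficient of `x ^ (k + 1)` in the power series of `sibuyaGen β x`; the constant
coefficient is `0`. -/
noncomputable def sibuyaCoeff (β : ℝ) (k : ℕ) : ℝ := -((-1) ^ (k + 1) * Ring.choose β (k + 1))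

section Sibuya

variable {β : ℝ}

theorem succ_mul_sibuyaCoeff_succ (β : ℝ) (k : ℕ) :
    ((k : ℝ) + 2) * sibuyaCoeff β (k + 1) = sibuyaCoeff β k * ((k : ℝ) + 1 - β) := by
  have h := Ring.choose_smul_choose β (n := k + 2) (k := k + 1) (by omega)
  rw [show (k + 2 - (k + 1) : ℕ) = 1 by omega, Ring.choose_one_right,
    Nat.choose_succ_self_right, nsmul_eq_mul] at h
  push_cast at h
  simp only [sibuyaCoeff]
  linear_combination (-(-1 : ℝ) ^ (k + 1 + 1)) * h

theorem sibuyaCoeff_nonneg (h0 : 0 ≤ β) (h1 : β ≤ 1) (k : ℕ) : 0 ≤ sibuyaCoeff β k := by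
  induction k with
  | zero => simpa [sibuyaCoeff] using h0
  | succ k ih =>
    have hprod : 0 ≤ ((k : ℝ) + 2) * sibuyaCoeff β (k + 1) := by
      rw [succ_mul_sibuyaCoeff_succ]
      exact mul_nonneg ih (by linarith [k.cast_nonneg (α := ℝ)])
    exact nonneg_of_mul_nonneg_right hprod (by positivity)

theorem hasSum_sibuyaCoeff (β : ℝ) {x : ℝ} (h0 : 0 ≤ x) (h1 : x < 1) :
    HasSum (fun k => sibuyaCoeff β k * x ^ (k + 1)) (sibuyaGen β x) := by
  have hbinom := (Real.one_add_rpow_hasFPowerSeriesOnBall_zero (a := β)).hasSum (y := -x) (by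
    simp [Metric.mem_eball, edist_dist, abs_of_nonneg h0, h1])
  simp only [binomialSeries_apply, List.ofFn_const, List.prod_replicate, smul_eq_mul,
    zero_add] at hbinom
  have hshift := ((hasSum_nat_add_iff' 1).2 hbinom).neg
  simp only [Finset.range_one, Finset.sum_singleton, Ring.choose_zero_right, pow_zero,
    mul_one, neg_sub, ← sub_eq_add_neg] at hshift
  refine hshift.congr_fun fun k => ?_
  rw [sibuyaCoeff, neg_pow x]
  ring

theorem sibuyaGen_nonneg (hβ : 0 ≤ β) {x : ℝ} (h0 : 0 ≤ x) (h1 : x ≤ 1) : 0 ≤ sibuyaGen β x :=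
  sub_nonneg.2 (Real.rpow_le_one (sub_nonneg.2 h1) (by linarith) hβ)

theorem isGaussianSum_sum_sibuyaCoeff {δ : ℝ} (h0 : 0 ≤ β) (h1 : β ≤ 1) (hδ : 0 < δ) (N : ℕ) :
    IsGaussianSum fun ω => ∑ k ∈ Finset.range N,
      sibuyaCoeff β k * Real.exp (-(δ * ω ^ 2)) ^ (k + 1) := by
  induction N with
  | zero => simpa using IsGaussianSum.zero
  | succ N ih =>
    simp only [Finset.sum_range_succ]
    refine ih.add ?_
    convert IsGaussianSum.gaussian (sibuyaCoeff_nonneg h0 h1 N) (b := (N + 1) * δ)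
      (by positivity) using 3 with ω
    rw [← Real.exp_nat_mul]
    congr 1
    push_cast
    ring

theorem div_two_le_one_sub_exp_neg {u : ℝ} (h0 : 0 ≤ u) (h1 : u ≤ 1) :
    u / 2 ≤ 1 - Real.exp (-u) := by
  have hexp : Real.exp (-u) ≤ (1 + u)⁻¹ := by
    rw [Real.exp_neg]
    exact inv_anti₀ (by linarith) (by linarith [Real.add_one_le_exp u])
  have hinv : (1 + u)⁻¹ ≤ 1 - u / 2 := by
    rw [inv_le_iff_one_le_mul₀ (by linarith)]
    nlinarith
  linarith

theorem sibuyaGen_exp_neg_le (h0 : 0 < β) (h1 : β ≤ 1) {u : ℝ} (hu : 0 ≤ u) :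
    sibuyaGen β (Real.exp (-u)) ≤ Real.exp (-(u ^ β / 2)) := by
  have hexp : Real.exp (-u) ≤ 1 := by simpa using hu
  rcases le_total u 1 with hu1 | hu1
  · have hrpow : u ^ β / 2 ≤ (1 - Real.exp (-u)) ^ β := by
      calc u ^ β / 2 ≤ u ^ β / 2 ^ β := by
            gcongr
            exact (Real.rpow_le_rpow_of_exponent_le one_le_two h1).trans (by simp)
        _ = (u / 2) ^ β := (Real.div_rpow hu zero_le_two β).symm
        _ ≤ _ := Real.rpow_le_rpow (by positivity) (div_two_le_one_sub_exp_neg hu hu1) h0.le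
    calc sibuyaGen β (Real.exp (-u)) ≤ Real.exp (-(1 - Real.exp (-u)) ^ β) := by
          rw [sibuyaGen]
          linarith [Real.add_one_le_exp (-(1 - Real.exp (-u)) ^ β)]
      _ ≤ _ := by gcongr
  · have hbase : 1 - Real.exp (-u) ≤ (1 - Real.exp (-u)) ^ β :=
      Real.self_le_rpow_of_le_one (by linarith) (by linarith [Real.exp_pos (-u)]) h1
    have hrpow : u ^ β / 2 ≤ u := by
      linarith [Real.rpow_le_self_of_one_le hu1 h1]
    calc sibuyaGen β (Real.exp (-u)) ≤ Real.exp (-u) := by rw [sibuyaGen]; linarith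
      _ ≤ _ := by gcongr

theorem sibuyaGen_exp_neg_nonneg (h0 : 0 ≤ β) {u : ℝ} (hu : 0 ≤ u) :
    0 ≤ sibuyaGen β (Real.exp (-u)) :=
  sibuyaGen_nonneg h0 (Real.exp_pos _).le (by simpa using hu)

theorem sibuyaGen_exp_neg_pow_le (h0 : 0 < β) (h1 : β ≤ 1) {u : ℝ} (hu : 0 ≤ u) (n : ℕ) :
    sibuyaGen β (Real.exp (-u)) ^ n ≤ Real.exp (-(n * u ^ β / 2)) := by
  refine (pow_le_pow_left₀ (sibuyaGen_exp_neg_nonneg h0.le hu)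
    (sibuyaGen_exp_neg_le h0 h1 hu) n).trans_eq ?_
  rw [← Real.exp_nat_mul]
  congr 1
  ring

theorem tendsto_sibuyaGen_pow (h0 : 0 < β) {a u : ℝ} (ha : 0 < a) (hu : 0 < u) :
    Tendsto (fun n : ℕ => sibuyaGen β (Real.exp (-((a / n) ^ β⁻¹ * u))) ^ n)
      atTop (𝓝 (Real.exp (-(a * u ^ β)))) := by
  simp only [sibuyaGen, sub_eq_add_neg 1 ((1 - Real.exp _) ^ β)]
  refine Real.tendsto_one_add_pow_exp_of_tendsto ?_
  have hscale : Tendsto (fun n : ℕ => (a / (n : ℝ)) ^ β⁻¹ * u) atTop (𝓝[≠] 0) := by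
    refine tendsto_nhdsWithin_iff.2 ⟨?_, ?_⟩
    · have := ((tendsto_const_div_atTop_nhds_zero_nat a).rpow_const
        (p := β⁻¹) (Or.inr (by positivity))).mul_const u
      rwa [Real.zero_rpow (by positivity), zero_mul] at this
    · filter_upwards [eventually_gt_atTop 0] with n hn
      have : (0 : ℝ) < n := Nat.cast_pos.2 hn
      exact (by positivity : (a / n) ^ β⁻¹ * u ≠ 0)
  have hderiv : HasDerivAt (fun t : ℝ => 1 - Real.exp (-t)) 1 0 := by
    simpa using ((hasDerivAt_neg (0 : ℝ)).exp).const_sub 1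
  have hlim := (((hasDerivAt_iff_tendsto_slope.1 hderiv).comp hscale).rpow_const (p := β)
    (Or.inr h0.le)).const_mul (a * u ^ β) |>.neg
  rw [Real.one_rpow, mul_one] at hlim
  refine hlim.congr' ?_
  filter_upwards [eventually_gt_atTop 0] with n hn
  have : (0 : ℝ) < n := Nat.cast_pos.2 hn
  have hnn : 0 ≤ 1 - Real.exp (-((a / n) ^ β⁻¹ * u)) := by
    rw [sub_nonneg, Real.exp_le_one_iff]
    exact neg_nonpos.2 (by positivity)
  simp only [Function.comp_apply, slope_def_field, neg_zero, Real.exp_zero, sub_self, sub_zero]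
  rw [Real.div_rpow hnn (by positivity), Real.mul_rpow (by positivity) hu.le,
    Real.rpow_inv_rpow (by positivity) h0.ne']
  field_simp

end Sibuya

section StableCharFun

theorem integrable_exp_neg_mul_abs_rpow {a α : ℝ} (ha : 0 < a) (hα : 0 < α) :
    Integrable fun ω : ℝ => Real.exp (-(a * |ω| ^ α)) := by
  refine .of_integral_ne_zero ?_
  rw [integral_comp_abs (f := fun x => Real.exp (-(a * x ^ α)))]
  simp only [← neg_mul, integral_exp_neg_mul_rpow hα ha]
  have := Real.Gamma_pos_of_pos (by positivity : 0 < 1 / α + 1)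
  positivity

theorem mul_sq_rpow {δ : ℝ} (hδ : 0 ≤ δ) (β ω : ℝ) :
    (δ * ω ^ 2) ^ β = δ ^ β * |ω| ^ (2 * β) := by
  rw [Real.mul_rpow hδ (sq_nonneg ω), Real.rpow_mul (abs_nonneg ω), Real.rpow_two, sq_abs]

variable {β δ : ℝ}

theorem integrable_sibuyaGen_gaussian_pow (h0 : 0 < β) (h1 : β ≤ 1) (hδ : 0 < δ) {n : ℕ}
    (hn : n ≠ 0) : Integrable fun ω => sibuyaGen β (Real.exp (-(δ * ω ^ 2))) ^ n := by
  have hbound := integrable_exp_neg_mul_abs_rpow (a := n * δ ^ β / 2) (α := 2 * β)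
    (by positivity) (by positivity)
  refine hbound.mono' (Measurable.aestronglyMeasurable (by unfold sibuyaGen; fun_prop))
    (ae_of_all _ fun ω => ?_)
  have hu : 0 ≤ δ * ω ^ 2 := by positivity
  rw [Real.norm_of_nonneg (pow_nonneg (sibuyaGen_exp_neg_nonneg h0.le hu) n)]
  refine (sibuyaGen_exp_neg_pow_le h0 h1 hu n).trans_eq ?_
  rw [mul_sq_rpow hδ.le]
  ring_nf

theorem isGaussianMixtureLike_cosTransform_sibuyaGen_gaussian_pow (h0 : 0 < β) (h1 : β ≤ 1)
    (hδ : 0 < δ) {n : ℕ} (hn : n ≠ 0) :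
    IsGaussianMixtureLike (cosTransform fun ω => sibuyaGen β (Real.exp (-(δ * ω ^ 2))) ^ n) := by
  have hpartial := fun N => (isGaussianSum_sum_sibuyaCoeff h0.le h1 hδ N).pow hn
  have hterm : ∀ (ω : ℝ) k, 0 ≤ sibuyaCoeff β k * Real.exp (-(δ * ω ^ 2)) ^ (k + 1) := fun ω k =>
    mul_nonneg (sibuyaCoeff_nonneg h0.le h1 k) (by positivity)
  have hseries : ∀ᵐ ω : ℝ, HasSum
      (fun k => sibuyaCoeff β k * Real.exp (-(δ * ω ^ 2)) ^ (k + 1))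
      (sibuyaGen β (Real.exp (-(δ * ω ^ 2)))) := by
    filter_upwards [Measure.ae_ne volume 0] with ω hω
    exact hasSum_sibuyaCoeff β (Real.exp_pos _).le
      (Real.exp_lt_one_iff.2 (neg_lt_zero.2 (by positivity)))
  refine isGaussianMixtureLike_cosTransform_of_tendsto
    (fun N => (hpartial N).isGaussianMixtureLike_cosTransform)
    (fun N => (hpartial N).integrable.aestronglyMeasurable)
    (integrable_sibuyaGen_gaussian_pow h0 h1 hδ hn) (fun N => ?_) ?_
  · filter_upwards [hseries] with ω hω
    have hnn := Finset.sum_nonneg fun k (_ : k ∈ Finset.range N) => hterm ω k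
    rw [abs_of_nonneg (pow_nonneg hnn n)]
    exact pow_le_pow_left₀ hnn (sum_le_hasSum _ (fun k _ => hterm ω k) hω) n
  · filter_upwards [hseries] with ω hω using hω.tendsto_sum_nat.pow n

theorem isGaussianMixtureLike_cosTransform_exp_neg_mul_abs_rpow {α a : ℝ} (h0 : 0 < α)
    (h2 : α ≤ 2) (ha : 0 < a) :
    IsGaussianMixtureLike (cosTransform fun ω => Real.exp (-(a * |ω| ^ α))) := by
  obtain ⟨β, rfl⟩ : ∃ β, α = 2 * β := ⟨α / 2, by ring⟩
  have hβ0 : 0 < β := by linarith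
  have hβ1 : β ≤ 1 := by linarith
  have hδ (n : ℕ) : 0 < (a / (n + 1 : ℕ)) ^ β⁻¹ := by positivity
  refine isGaussianMixtureLike_cosTransform_of_tendsto
    (B := fun ω => Real.exp (-(a / 2 * |ω| ^ (2 * β))))
    (fun n => isGaussianMixtureLike_cosTransform_sibuyaGen_gaussian_pow hβ0 hβ1 (hδ n)
      n.succ_ne_zero)
    (fun n => (integrable_sibuyaGen_gaussian_pow hβ0 hβ1 (hδ n)
      n.succ_ne_zero).aestronglyMeasurable)
    (integrable_exp_neg_mul_abs_rpow (by positivity) h0)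
    (fun n => ae_of_all _ fun ω => ?_) ?_
  · have hu : 0 ≤ (a / (n + 1 : ℕ)) ^ β⁻¹ * ω ^ 2 := by positivity
    rw [abs_of_nonneg (pow_nonneg (sibuyaGen_exp_neg_nonneg hβ0.le hu) _)]
    refine (sibuyaGen_exp_neg_pow_le hβ0 hβ1 hu (n + 1)).trans_eq ?_
    rw [mul_sq_rpow (hδ n).le, Real.rpow_inv_rpow (by positivity) hβ0.ne']
    field_simp
  · filter_upwards [Measure.ae_ne volume 0] with ω hω
    have := tendsto_sibuyaGen_pow hβ0 ha (by positivity : 0 < ω ^ 2)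
    rw [← one_mul (ω ^ 2), mul_sq_rpow zero_le_one, Real.one_rpow] at this
    simpa only [one_mul, Function.comp_def] using this.comp (tendsto_add_atTop_nat 1)

end StableCharFun

section RefDensity

variable {α : ℝ}

theorem refDensity_eq (h0 : 0 < α) (x : ℝ) :
    refDensity α x = (2 * Real.pi)⁻¹ * cosTransform (fun ω => Real.exp (-(1 / α * |ω| ^ α))) x := by
  have hγ : ((1 / α) ^ (1 / α)) ^ α = 1 / α := by
    rw [← Real.rpow_mul (by positivity), one_div_mul_cancel h0.ne', Real.rpow_one]
  have hcos := ofReal_cosTransform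
    (integrable_exp_neg_mul_abs_rpow (a := 1 / α) (by positivity) h0) (by simp) (-x)
  simp only [refDensity, sasDensity, sasCharFun, hγ]
  rw [← cosTransform_neg, ← Complex.ofReal_re (cosTransform _ _), hcos]
  simp only [Complex.ofReal_neg, mul_neg, neg_mul]

theorem isGaussianMixtureLike_refDensity (h0 : 0 < α) (h2 : α ≤ 2) :
    IsGaussianMixtureLike (refDensity α) := by
  rw [funext (refDensity_eq h0)]
  exact (isGaussianMixtureLike_cosTransform_exp_neg_mul_abs_rpow h0 h2 (by positivity)).const_mul
    (by positivity)

theorem continuous_refDensity (h0 : 0 < α) : Continuous (refDensity α) := by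
  rw [funext (refDensity_eq h0)]
  exact (continuous_cosTransform
    (integrable_exp_neg_mul_abs_rpow (by positivity) h0)).const_mul _

theorem refDensity_pos (h0 : 0 < α) (h2 : α ≤ 2) (x : ℝ) : 0 < refDensity α x := by
  refine (isGaussianMixtureLike_refDensity h0 h2).pos (continuous_refDensity h0).continuousAt ?_ x
  rw [refDensity_eq h0]
  refine (mul_pos (by positivity) ?_).ne'
  simp only [cosTransform, mul_zero, Real.cos_zero, one_mul]
  exact integral_exp_pos (integrable_exp_neg_mul_abs_rpow (by positivity) h0)

theorem integrable_refDensity (h0 : 0 < α) (h2 : α ≤ 2) : Integrable (refDensity α) := by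
  have hmix := isGaussianMixtureLike_cosTransform_exp_neg_mul_abs_rpow (a := 1 / α) h0 h2
    (by positivity)
  rw [funext (refDensity_eq h0)]
  refine (integrable_cosTransform_of_nonneg (M := 1)
    (integrable_exp_neg_mul_abs_rpow (by positivity) h0) (fun ω => ?_) hmix.nonneg).const_mul _
  exact Real.exp_le_one_iff.2 (neg_nonpos.2 (by positivity))

theorem cosTransform_refDensity (h0 : 0 < α) (h2 : α ≤ 2) (ω : ℝ) :
    cosTransform (refDensity α) ω = Real.exp (-(1 / α * |ω| ^ α)) := by
  have hint : Integrable (cosTransform fun ω => Real.exp (-(1 / α * |ω| ^ α))) := by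
    refine ((integrable_refDensity h0 h2).const_mul (2 * Real.pi)).congr (ae_of_all _ fun x => ?_)
    simp only [refDensity_eq h0]
    exact mul_inv_cancel_left₀ (by positivity) _
  rw [funext (refDensity_eq h0), cosTransform_const_mul, cosTransform_cosTransform
    (integrable_exp_neg_mul_abs_rpow (by positivity) h0)
    (continuous_const.mul (continuous_abs.rpow_const fun _ => Or.inr h0.le)).neg.rexp (by simp)
    hint, inv_mul_cancel_left₀ (by positivity)]

theorem integral_refDensity (h0 : 0 < α) (h2 : α ≤ 2) : ∫ x, refDensity α x = 1 := by
  simpa [cosTransform, Real.zero_rpow h0.ne'] using cosTransform_refDensity h0 h2 0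

/-- The reference stable law, that is, the measure with density `refDensity α`. -/
noncomputable def refMeasure (α : ℝ) : Measure ℝ :=
  volume.withDensity fun x => ENNReal.ofReal (refDensity α x)

theorem isProbabilityMeasure_refMeasure (h0 : 0 < α) (h2 : α ≤ 2) :
    IsProbabilityMeasure (refMeasure α) := by
  constructor
  rw [refMeasure, withDensity_apply _ .univ, Measure.restrict_univ,
    ← ofReal_integral_eq_lintegral_ofReal (integrable_refDensity h0 h2)
      (ae_of_all _ fun x => (refDensity_pos h0 h2 x).le),
    integral_refDensity h0 h2, ENNReal.ofReal_one]

theorem charFun_refMeasure (h0 : 0 < α) (h2 : α ≤ 2) (t : ℝ) :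
    charFun (refMeasure α) t = Real.exp (-(1 / α * |t| ^ α)) := by
  rw [← cosTransform_refDensity h0 h2, ofReal_cosTransform (integrable_refDensity h0 h2)
    (isGaussianMixtureLike_refDensity h0 h2).even, charFun_apply_real, refMeasure,
    integral_withDensity_eq_integral_toReal_smul
      (continuous_refDensity h0).measurable.ennreal_ofReal (by simp)]
  congr! 1
  ext x
  rw [ENNReal.toReal_ofReal (refDensity_pos h0 h2 x).le, Complex.real_smul, mul_comm,
    mul_comm (t : ℂ)]

theorem refMeasure_real_Ioc (h0 : 0 < α) (h2 : α ≤ 2) (a b : ℝ) :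
    (refMeasure α).real (Set.Ioc a b) = ∫ x in Set.Ioc a b, refDensity α x := by
  rw [Measure.real, refMeasure, withDensity_apply _ measurableSet_Ioc,
    integral_eq_lintegral_of_nonneg_ae (ae_of_all _ fun x => (refDensity_pos h0 h2 x).le)
      (continuous_refDensity h0).aestronglyMeasurable]

theorem refMeasure_real_abs_gt_le (h0 : 0 < α) (h2 : α ≤ 2) {r : ℝ} (hr : 0 < r) :
    (refMeasure α).real {x | r < |x|} ≤ 2 / α * (2 / r) ^ α := by
  have := isProbabilityMeasure_refMeasure h0 h2
  have hle : ∀ t ∈ Set.uIoc (-2 * r⁻¹) (2 * r⁻¹),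
      ‖1 - charFun (refMeasure α) t‖ ≤ 1 / α * (2 / r) ^ α := by
    intro t ht
    rw [neg_mul, ← div_eq_mul_inv, Set.uIoc_of_le (by linarith [div_pos two_pos hr])] at ht
    have habs : |t| ≤ 2 / r := abs_le.2 ⟨ht.1.le, ht.2⟩
    rw [charFun_refMeasure h0 h2, ← Complex.ofReal_one, ← Complex.ofReal_sub, Complex.norm_real,
      Real.norm_of_nonneg (sub_nonneg.2 (Real.exp_le_one_iff.2 (neg_nonpos.2 (by positivity))))]
    calc 1 - Real.exp (-(1 / α * |t| ^ α)) ≤ 1 / α * |t| ^ α := by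
          linarith [Real.one_sub_le_exp_neg (1 / α * |t| ^ α)]
      _ ≤ 1 / α * (2 / r) ^ α := by gcongr
  calc (refMeasure α).real {x | r < |x|}
      ≤ 2⁻¹ * r * ‖∫ t in (-2 * r⁻¹)..(2 * r⁻¹), 1 - charFun (refMeasure α) t‖ :=
        measureReal_abs_gt_le_integral_charFun hr
    _ ≤ 2⁻¹ * r * (1 / α * (2 / r) ^ α * |2 * r⁻¹ - -2 * r⁻¹|) := by
        gcongr
        exact intervalIntegral.norm_integral_le_of_norm_le_const hle
    _ = 2 / α * (2 / r) ^ α := by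
        rw [abs_of_pos (by ring_nf; positivity)]
        field_simp
        ring

theorem refDensity_two_mul_le (h0 : 0 < α) (h2 : α ≤ 2) {r : ℝ} (hr : 0 < r) :
    r * refDensity α (2 * r) ≤ 2 / α * (2 / r) ^ α := by
  have := isProbabilityMeasure_refMeasure h0 h2
  calc r * refDensity α (2 * r) = ∫ _ in Set.Ioc r (2 * r), refDensity α (2 * r) := by
        rw [setIntegral_const, Real.volume_real_Ioc_of_le (by linarith), smul_eq_mul]
        ring
    _ ≤ ∫ x in Set.Ioc r (2 * r), refDensity α x :=
        setIntegral_mono_on (integrableOn_const (by simp))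
          (integrable_refDensity h0 h2).integrableOn measurableSet_Ioc fun x hx =>
            (isGaussianMixtureLike_refDensity h0 h2).anti _ _
              (abs_le_abs_of_nonneg (hr.trans hx.1).le hx.2)
    _ = (refMeasure α).real (Set.Ioc r (2 * r)) := (refMeasure_real_Ioc h0 h2 _ _).symm
    _ ≤ (refMeasure α).real {x | r < |x|} :=
        measureReal_mono fun x hx => hx.1.trans_le (le_abs_self x)
    _ ≤ 2 / α * (2 / r) ^ α := refMeasure_real_abs_gt_le h0 h2 hr

theorem refDensity_isBigO_atTop (h0 : 0 < α) (h2 : α ≤ 2) :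
    refDensity α =O[atTop] fun x => x ^ (-(1 + α)) := by
  refine .of_bound (4 / α * 4 ^ α) ?_
  filter_upwards [eventually_gt_atTop 0] with x hx
  have h := refDensity_two_mul_le h0 h2 (half_pos hx)
  rw [mul_div_cancel₀ x two_ne_zero, show 2 / (x / 2) = 4 / x by field_simp; norm_num,
    Real.div_rpow zero_le_four hx.le] at h
  rw [Real.norm_of_nonneg (refDensity_pos h0 h2 x).le, Real.norm_of_nonneg (by positivity),
    Real.rpow_neg hx.le, Real.rpow_add hx, Real.rpow_one]
  calc refDensity α x = 2 / x * (x / 2 * refDensity α x) := by field_simp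
    _ ≤ 2 / x * (2 / α * (4 ^ α / x ^ α)) := by gcongr
    _ = 4 / α * 4 ^ α * (x * x ^ α)⁻¹ := by field_simp; ring

theorem tendsto_refDensity_atTop (h0 : 0 < α) (h2 : α ≤ 2) :
    Tendsto (refDensity α) atTop (𝓝 0) :=
  (refDensity_isBigO_atTop h0 h2).trans_tendsto (tendsto_rpow_neg_atTop (by positivity))

theorem refDensity_lt_of_abs_lt (h0 : 0 < α) (h2 : α ≤ 2) {x y : ℝ} (hxy : |x| < |y|) :
    refDensity α y < refDensity α x :=
  (isGaussianMixtureLike_refDensity h0 h2).apply_lt_of_abs_lt (refDensity_pos h0 h2)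
    (tendsto_refDensity_atTop h0 h2) hxy

theorem continuous_log_refDensity (h0 : 0 < α) (h2 : α ≤ 2) :
    Continuous fun x => Real.log (refDensity α x) :=
  (continuous_refDensity h0).log fun x => (refDensity_pos h0 h2 x).ne'

theorem log_refDensity_le_of_abs_le (h0 : 0 < α) (h2 : α ≤ 2) {x y : ℝ} (h : |x| ≤ |y|) :
    Real.log (refDensity α y) ≤ Real.log (refDensity α x) :=
  Real.log_le_log (refDensity_pos h0 h2 y) ((isGaussianMixtureLike_refDensity h0 h2).anti _ _ h)

theorem log_refDensity_lt_of_abs_lt (h0 : 0 < α) (h2 : α ≤ 2) {x y : ℝ} (h : |x| < |y|) :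
    Real.log (refDensity α y) < Real.log (refDensity α x) :=
  Real.log_lt_log (refDensity_pos h0 h2 y) (refDensity_lt_of_abs_lt h0 h2 h)

theorem refDensity_mul_log_isBigO_atTop (h0 : 0 < α) (h2 : α ≤ 2) :
    (fun x => refDensity α x * Real.log (refDensity α x)) =O[atTop]
      fun x => x ^ (-(1 + α / 2)) := by
  let η : ℝ := α / (2 * (1 + α))
  have hη : 0 < η := by positivity
  have hη1 : 0 ≤ 1 - η := sub_nonneg.2 ((div_le_one (by positivity)).2 (by linarith))
  have hpos := refDensity_pos h0 h2
  have hlim : Tendsto (refDensity α) atTop (𝓝[>] 0) :=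
    tendsto_nhdsWithin_iff.2 ⟨tendsto_refDensity_atTop h0 h2, Eventually.of_forall hpos⟩
  have hlog := ((isLittleO_log_rpow_nhdsGT_zero (neg_lt_zero.2 hη)).comp_tendsto hlim).isBigO
  refine ((Asymptotics.isBigO_refl (refDensity α) atTop).mul hlog).trans ?_
  refine .trans_eventuallyEq (g₁ := fun x => (x ^ (-(1 + α))) ^ (1 - η)) ?_ ?_
  · refine .congr_left ((refDensity_isBigO_atTop h0 h2).rpow hη1 ?_) fun x => ?_
    · filter_upwards [eventually_ge_atTop 0] with x hx using by positivity
    · rw [Function.comp_apply, sub_eq_add_neg, Real.rpow_add (hpos x), Real.rpow_one]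
  · filter_upwards [eventually_ge_atTop 0] with x hx
    rw [← Real.rpow_mul hx]
    congr 1
    simp only [η]
    field_simp
    ring

theorem integrable_refDensity_mul_log (h0 : 0 < α) (h2 : α ≤ 2) :
    Integrable fun x => refDensity α x * Real.log (refDensity α x) :=
  ((continuous_refDensity h0).mul
    (continuous_log_refDensity h0 h2)).locallyIntegrable
    |>.integrable_of_isBigO_atTop_of_norm_isNegInvariant
      (ae_of_all _ fun x => by
        simp only [Function.comp_apply, Pi.mul_apply,
          (isGaussianMixtureLike_refDensity h0 h2).even])
      (refDensity_mul_log_isBigO_atTop h0 h2)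
      (integrableAtFilter_rpow_atTop_iff.2 (by linarith))

theorem neg_log_refDensity_zero_lt_refEntropy (h0 : 0 < α) (h2 : α ≤ 2) :
    -Real.log (refDensity α 0) < refEntropy α := by
  have hmul := (integrable_refDensity h0 h2).mul_const (Real.log (refDensity α 0))
  have hmul_log := integrable_refDensity_mul_log h0 h2
  have hpos : 0 < ∫ x, (refDensity α x * Real.log (refDensity α 0) -
      refDensity α x * Real.log (refDensity α x)) := by
    refine integral_pos_of_integrable_nonneg_nonzero (x := 1)
      (((continuous_refDensity h0).mul_const _).sub
        ((continuous_refDensity h0).mul (continuous_log_refDensity h0 h2)))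
      (hmul.sub hmul_log) (fun x => ?_) (ne_of_gt ?_)
    · exact sub_nonneg.2 (mul_le_mul_of_nonneg_left
        (log_refDensity_le_of_abs_le h0 h2 (by simp)) (refDensity_pos h0 h2 x).le)
    · exact sub_pos.2 (mul_lt_mul_of_pos_left
        (log_refDensity_lt_of_abs_lt h0 h2 (by simp)) (refDensity_pos h0 h2 1))
  rw [integral_sub hmul hmul_log, integral_mul_const, integral_refDensity h0 h2, one_mul] at hpos
  rw [refEntropy]
  linarith

end RefDensity

section Equidistribution

theorem tendsto_integral_of_tendsto_integral_of_dense {K ι : Type*} [TopologicalSpace K]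
    [CompactSpace K] [MeasurableSpace K] [OpensMeasurableSpace K] {μ : ι → Measure K}
    [∀ i, IsProbabilityMeasure (μ i)] {ν : Measure K} [IsProbabilityMeasure ν] {l : Filter ι}
    {S : Set C(K, ℂ)} (hS : (Submodule.span ℂ S).topologicalClosure = ⊤)
    (h : ∀ f ∈ S, Tendsto (fun i => ∫ x, f x ∂μ i) l (𝓝 (∫ x, f x ∂ν))) (f : C(K, ℂ)) :
    Tendsto (fun i => ∫ x, f x ∂μ i) l (𝓝 (∫ x, f x ∂ν)) := by
  have hint (μ : Measure K) [IsProbabilityMeasure μ] (f : C(K, ℂ)) : Integrable f μ :=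
    f.continuous.integrable_of_hasCompactSupport (.of_compactSpace f)
  have hlip (μ : Measure K) [IsProbabilityMeasure μ] :
      LipschitzWith 1 fun f : C(K, ℂ) => ∫ x, f x ∂μ := by
    refine .of_dist_le_mul fun f g => ?_
    rw [dist_eq_norm, ← integral_sub (hint μ f) (hint μ g), dist_eq_norm, mul_comm]
    simpa using norm_integral_le_of_norm_le_const (μ := μ)
      (ae_of_all _ fun x => (f - g).norm_coe_le_norm x)
  have hspan : ∀ f ∈ Submodule.span ℂ S,
      Tendsto (fun i => ∫ x, f x ∂μ i) l (𝓝 (∫ x, f x ∂ν)) := by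
    intro f hf
    induction hf using Submodule.span_induction with
    | mem f hf => exact h f hf
    | zero => simpa using tendsto_const_nhds
    | add f g _ _ hf hg =>
      simpa only [ContinuousMap.add_apply, integral_add (hint _ f) (hint _ g)] using hf.add hg
    | smul c f _ hf =>
      simpa only [ContinuousMap.smul_apply, integral_smul] using hf.const_smul c
  have hclosed : IsClosed {f : C(K, ℂ) | Tendsto (fun i => ∫ x, f x ∂μ i) l (𝓝 (∫ x, f x ∂ν))} :=
    (LipschitzWith.uniformEquicontinuous _ 1 fun i => hlip (μ i)).equicontinuous
      |>.isClosed_setOfPred_tendsto (hlip ν).continuous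
  refine closure_minimal hspan hclosed ?_
  rw [← Submodule.topologicalClosure_coe, hS]
  trivial

theorem integral_fourier_of_ne_zero {T : ℝ} [Fact (0 < T)] {n : ℤ} (hn : n ≠ 0) :
    ∫ x : AddCircle T, fourier n x ∂AddCircle.haarAddCircle = 0 := by
  simpa [fourierCoeff, hn.symm] using congrFun (fourierCoeff_fourier (T := T) n) 0

theorem tendsto_charFun_cocompact {μ : Measure ℝ} [IsFiniteMeasure μ] (hμ : μ ≪ volume) :
    Tendsto (charFun μ) (cocompact ℝ) (𝓝 0) := by
  have hRL := Real.tendsto_integral_exp_smul_cocompact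
    (fun x : ℝ => (((μ.rnDeriv volume x).toReal : ℝ) : ℂ))
  have hscale : Tendsto (fun t : ℝ => -(2 * Real.pi)⁻¹ * t) (cocompact ℝ) (cocompact ℝ) :=
    (Homeomorph.mulLeft₀ (-(2 * Real.pi)⁻¹) (by simp)).isClosedEmbedding.tendsto_cocompact
  refine (hRL.comp hscale).congr fun t => ?_
  rw [charFun_apply_real, ← integral_rnDeriv_smul hμ]
  refine integral_congr_ae (ae_of_all _ fun x => ?_)
  simp only [Circle.smul_def, Real.fourierChar_apply, smul_eq_mul, Complex.real_smul]
  rw [mul_comm]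
  congr 2
  push_cast
  field_simp

theorem tendsto_integral_div_addCircle {μ : Measure ℝ} [IsProbabilityMeasure μ]
    (hμ : Tendsto (charFun μ) (cocompact ℝ) (𝓝 0)) (Φ : C(UnitAddCircle, ℂ)) :
    Tendsto (fun Δ : ℝ => ∫ x, Φ ((x / Δ : ℝ) : UnitAddCircle) ∂μ) (𝓝[>] 0)
      (𝓝 (∫ b, Φ b ∂AddCircle.haarAddCircle)) := by
  have hm (Δ : ℝ) : Measurable fun x : ℝ => ((x / Δ : ℝ) : UnitAddCircle) :=
    ((AddCircle.continuous_mk' (1 : ℝ)).comp (continuous_id.div_const Δ)).measurable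
  have hmap (Φ : C(UnitAddCircle, ℂ)) (Δ : ℝ) :
      ∫ b, Φ b ∂(μ.map fun x : ℝ => ((x / Δ : ℝ) : UnitAddCircle)) =
        ∫ x, Φ ((x / Δ : ℝ) : UnitAddCircle) ∂μ :=
    integral_map (hm Δ).aemeasurable Φ.continuous.aestronglyMeasurable
  have (Δ : ℝ) := Measure.isProbabilityMeasure_map (μ := μ) (hm Δ).aemeasurable
  simp only [← hmap]
  refine tendsto_integral_of_tendsto_integral_of_dense span_fourier_closure_eq_top ?_ Φ
  rintro _ ⟨n, rfl⟩
  rcases eq_or_ne n 0 with rfl | hn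
  · simp
  rw [integral_fourier_of_ne_zero hn]
  have hfreq : Tendsto (fun Δ : ℝ => 2 * Real.pi * n * Δ⁻¹) (𝓝[>] 0) (cocompact ℝ) :=
    (Homeomorph.mulLeft₀ (2 * Real.pi * n) (by simp [hn, Real.pi_ne_zero])).isClosedEmbedding
      |>.tendsto_cocompact.comp (tendsto_inv_nhdsGT_zero.mono_right atTop_le_cocompact)
  refine (hμ.comp hfreq).congr fun Δ => ?_
  rw [hmap, Function.comp_apply, charFun_apply_real]
  refine integral_congr_ae (ae_of_all _ fun x => ?_)
  simp only [fourier_coe_apply]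
  congr 1
  push_cast
  ring

variable {Δ : ℝ}

theorem quantizationError_mem_Ioc (hΔ : 0 < Δ) (x : ℝ) :
    (x - uniformQuantizer Δ x) / Δ ∈ Set.Ioc (-(1 / 2) : ℝ) (1 / 2) := by
  rw [uniformQuantizer, sub_div, mul_div_cancel_right₀ _ hΔ.ne']
  have h1 := Int.le_ceil (x / Δ - 1 / 2)
  have h2 := Int.ceil_lt_add_one (x / Δ - 1 / 2)
  constructor <;> linarith

theorem coe_quantizationError (hΔ : 0 < Δ) (x : ℝ) :
    (((x - uniformQuantizer Δ x) / Δ : ℝ) : UnitAddCircle) = ((x / Δ : ℝ) : UnitAddCircle) := by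
  rw [uniformQuantizer, sub_div, mul_div_cancel_right₀ _ hΔ.ne', AddCircle.coe_sub, sub_eq_self,
    AddCircle.coe_eq_zero_iff]
  exact ⟨⌈x / Δ - 1 / 2⌉, by simp⟩

theorem measurable_uniformQuantizer (Δ : ℝ) : Measurable (uniformQuantizer Δ) := by
  unfold uniformQuantizer
  fun_prop

theorem tendsto_integral_quantizationError {μ : Measure ℝ} [IsProbabilityMeasure μ]
    (hμ : Tendsto (charFun μ) (cocompact ℝ) (𝓝 0)) {φ : ℝ → ℝ} (hφ : Continuous φ)
    (hends : φ (-(1 / 2)) = φ (1 / 2)) :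
    Tendsto (fun Δ : ℝ => ∫ x, φ ((x - uniformQuantizer Δ x) / Δ) ∂μ) (𝓝[>] 0)
      (𝓝 (∫ x in (-(1 / 2 : ℝ))..(1 / 2), φ x)) := by
  have hone : (-(1 / 2) + 1 : ℝ) = 1 / 2 := by norm_num
  let Φ : C(UnitAddCircle, ℂ) :=
    ⟨AddCircle.liftIoc 1 (-(1 / 2)) fun x => ((φ x : ℝ) : ℂ),
      AddCircle.liftIoc_continuous (by rw [hone, hends]) (by fun_prop)⟩
  have hΦ : ∀ x ∈ Set.Ioc (-(1 / 2) : ℝ) (1 / 2), Φ (x : UnitAddCircle) = φ x := fun x hx =>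
    AddCircle.liftIoc_coe_apply (f := fun x => ((φ x : ℝ) : ℂ)) (by rwa [hone])
  have hΦ_integral : ∫ b, Φ b ∂AddCircle.haarAddCircle =
      ((∫ x in (-(1 / 2 : ℝ))..(1 / 2), φ x : ℝ) : ℂ) := by
    rw [AddCircle.integral_haarAddCircle, inv_one, one_smul,
      ← UnitAddCircle.integral_preimage (-(1 / 2)), hone,
      intervalIntegral.integral_of_le (by norm_num), ← integral_complex_ofReal]
    exact setIntegral_congr_fun measurableSet_Ioc hΦ
  have hlim := (Complex.continuous_re.tendsto _).comp (tendsto_integral_div_addCircle hμ Φ)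
  rw [hΦ_integral, Complex.ofReal_re] at hlim
  refine hlim.congr' ?_
  filter_upwards [self_mem_nhdsWithin] with Δ hΔ
  have hΦ_div (x : ℝ) : Φ ((x / Δ : ℝ) : UnitAddCircle) =
      ((φ ((x - uniformQuantizer Δ x) / Δ) : ℝ) : ℂ) := by
    rw [← coe_quantizationError hΔ, hΦ _ (quantizationError_mem_Ioc hΔ x)]
  simp only [Function.comp_apply, hΦ_div, integral_complex_ofReal, Complex.ofReal_re]

end Equidistribution

section Uniform

variable {Ω : Type*} [MeasurableSpace Ω] {P : Measure Ω} {U : Ω → ℝ} {a b : ℝ}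

theorem aemeasurable_of_isUniform_Ioo (hab : a < b)
    (hU : pdf.IsUniform U (Set.Ioo a b) P volume) : AEMeasurable U P :=
  hU.aemeasurable (by simpa using hab) (by simp)

theorem ae_mem_Ioo_of_isUniform (hab : a < b) (hU : pdf.IsUniform U (Set.Ioo a b) P volume) :
    ∀ᵐ w ∂P, U w ∈ Set.Ioo a b := by
  refine ae_of_ae_map (aemeasurable_of_isUniform_Ioo hab hU) ?_
  rw [hU]
  exact ae_cond_mem measurableSet_Ioo

theorem integral_comp_of_isUniform_Ioo (hab : a < b)
    (hU : pdf.IsUniform U (Set.Ioo a b) P volume) {φ : ℝ → ℝ} (hφ : Continuous φ) :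
    ∫ w, φ (U w) ∂P = (b - a)⁻¹ * ∫ x in a..b, φ x := by
  rw [← integral_map (aemeasurable_of_isUniform_Ioo hab hU) hφ.aestronglyMeasurable, hU,
    ProbabilityTheory.cond, integral_smul_measure, Real.volume_Ioo, ENNReal.toReal_inv,
    ENNReal.toReal_ofReal (sub_nonneg.2 hab.le), intervalIntegral.integral_of_le hab.le,
    integral_Ioc_eq_integral_Ioo, smul_eq_mul]

end Uniform

section Strength

variable {Ω : Type*} [MeasurableSpace Ω] {P : Measure Ω} {α : ℝ} {Y : Ω → ℝ} {s t : ℝ}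

theorem strength_nonneg (α : ℝ) (Y : Ω → ℝ) (P : Measure Ω) : 0 ≤ strength α Y P :=
  Real.sInf_nonneg fun _ hs => hs.1.le

theorem strength_le_of_mem_strengthSet (hs : s ∈ strengthSet α Y P) : strength α Y P ≤ s :=
  csInf_le ⟨0, fun _ hs => hs.1.le⟩ hs

open scoped Pointwise in
theorem strengthSet_div_const {c : ℝ} (hc : 0 < c) :
    strengthSet α (fun w => Y w / c) P = c⁻¹ • strengthSet α Y P := by
  ext s
  rw [Set.mem_smul_set_iff_inv_smul_mem₀ (inv_ne_zero hc.ne'), inv_inv, smul_eq_mul]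
  simp only [strengthSet, Set.mem_ofPred_eq, div_div, mul_pos_iff_of_pos_left hc]

theorem strength_div_const {c : ℝ} (hc : 0 < c) :
    strength α (fun w => Y w / c) P = strength α Y P / c := by
  rw [strength, strengthSet_div_const hc, Real.sInf_smul_of_nonneg (inv_nonneg.2 hc.le),
    smul_eq_mul, inv_mul_eq_div, strength]

theorem log_refDensity_div_le_log_refDensity_div (h0 : 0 < α) (h2 : α ≤ 2) (hs : 0 < s)
    (hst : s ≤ t) (x : ℝ) : Real.log (refDensity α (x / s)) ≤ Real.log (refDensity α (x / t)) := by
  refine log_refDensity_le_of_abs_le h0 h2 ?_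
  rw [abs_div, abs_div, abs_of_pos hs, abs_of_pos (hs.trans_le hst)]
  gcongr

theorem log_refDensity_div_lt_log_refDensity_div (h0 : 0 < α) (h2 : α ≤ 2) (hs : 0 < s)
    (hst : s < t) {x : ℝ} (hx : x ≠ 0) :
    Real.log (refDensity α (x / s)) < Real.log (refDensity α (x / t)) := by
  refine log_refDensity_lt_of_abs_lt h0 h2 ?_
  rw [abs_div, abs_div, abs_of_pos hs, abs_of_pos (hs.trans hst)]
  gcongr

theorem aestronglyMeasurable_log_refDensity_div (h0 : 0 < α) (h2 : α ≤ 2)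
    (hY : AEMeasurable Y P) (s : ℝ) :
    AEStronglyMeasurable (fun w => Real.log (refDensity α (Y w / s))) P :=
  (continuous_log_refDensity h0 h2).comp_aestronglyMeasurable (hY.div_const s).aestronglyMeasurable

theorem mem_strengthSet_of_le [IsFiniteMeasure P] (h0 : 0 < α) (h2 : α ≤ 2)
    (hY : AEMeasurable Y P) (hs : s ∈ strengthSet α Y P) (hst : s ≤ t) :
    t ∈ strengthSet α Y P := by
  obtain ⟨hs0, hsi, hsle⟩ := hs
  have hmono (w : Ω) := log_refDensity_div_le_log_refDensity_div h0 h2 hs0 hst (Y w)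
  have hti : Integrable (fun w => Real.log (refDensity α (Y w / t))) P :=
    integrable_of_le_of_le (aestronglyMeasurable_log_refDensity_div h0 h2 hY t) (ae_of_all _ hmono)
      (ae_of_all _ fun w => log_refDensity_le_of_abs_le h0 h2 (by simp))
      hsi (integrable_const (Real.log (refDensity α 0)))
  exact ⟨hs0.trans_le hst, hti, (neg_le_neg (integral_mono hsi hti hmono)).trans hsle⟩

theorem mem_strengthSet_of_strength_lt [IsFiniteMeasure P] (h0 : 0 < α) (h2 : α ≤ 2)
    (hY : AEMeasurable Y P) (hex : StrengthExists α Y P) (ht : strength α Y P < t) :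
    t ∈ strengthSet α Y P := by
  obtain ⟨s, hs, hst⟩ := exists_lt_of_csInf_lt hex ht
  exact mem_strengthSet_of_le h0 h2 hY hs hst.le

theorem neg_integral_log_refDensity_div_lt_refEntropy [IsProbabilityMeasure P] (h0 : 0 < α)
    (h2 : α ≤ 2) (hY : AEMeasurable Y P) (hex : StrengthExists α Y P)
    (ht : strength α Y P < t) :
    -∫ w, Real.log (refDensity α (Y w / t)) ∂P < refEntropy α := by
  obtain ⟨s, ⟨hs0, hsi, hsle⟩, hst⟩ := exists_lt_of_csInf_lt hex ht
  obtain ⟨-, hti, -⟩ := mem_strengthSet_of_strength_lt h0 h2 hY hex ht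
  have hmono (w : Ω) := log_refDensity_div_le_log_refDensity_div h0 h2 hs0 hst.le (Y w)
  rcases (integral_mono hsi hti hmono).lt_or_eq with hlt | heq
  · exact (neg_lt_neg hlt).trans_le hsle
  -- Equal costs at two levels force `Y = 0`, and the cost of `0` is below the entropy.
  have hY0 : ∀ᵐ w ∂P, Y w = 0 := by
    filter_upwards [(integral_eq_iff_of_ae_le hsi hti (ae_of_all _ hmono)).1 heq] with w hw
    by_contra hne
    exact (log_refDensity_div_lt_log_refDensity_div h0 h2 hs0 hst hne).ne hw
  have hcost : ∫ w, Real.log (refDensity α (Y w / t)) ∂P = Real.log (refDensity α 0) := by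
    rw [integral_congr_ae (g := fun _ => Real.log (refDensity α 0))]
    · simp
    · filter_upwards [hY0] with w hw
      rw [hw, zero_div]
  rw [hcost]
  exact neg_log_refDensity_zero_lt_refEntropy h0 h2

theorem refEntropy_lt_neg_integral_log_refDensity_div (ht0 : 0 < t)
    (hti : Integrable (fun w => Real.log (refDensity α (Y w / t))) P)
    (ht : t < strength α Y P) : refEntropy α < -∫ w, Real.log (refDensity α (Y w / t)) ∂P := by
  contrapose! ht
  exact strength_le_of_mem_strengthSet ⟨ht0, hti, ht⟩

theorem ae_log_refDensity_lpNorm_div_le (h0 : 0 < α) (h2 : α ≤ 2) (hY : MemLp Y ⊤ P) (s : ℝ) :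
    ∀ᵐ w ∂P, Real.log (refDensity α (lpNorm Y ⊤ P / s)) ≤ Real.log (refDensity α (Y w / s)) := by
  filter_upwards [ae_le_lpNorm_exponent_top hY] with w hw
  refine log_refDensity_le_of_abs_le h0 h2 ?_
  rw [abs_div, abs_div]
  exact div_le_div_of_nonneg_right (hw.trans (le_abs_self _)) (abs_nonneg s)

theorem integrable_log_refDensity_div [IsFiniteMeasure P] (h0 : 0 < α) (h2 : α ≤ 2)
    (hY : MemLp Y ⊤ P) (s : ℝ) : Integrable (fun w => Real.log (refDensity α (Y w / s))) P :=
  integrable_of_le_of_le (aestronglyMeasurable_log_refDensity_div h0 h2 hY.aemeasurable s)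
    (ae_log_refDensity_lpNorm_div_le h0 h2 hY s)
    (ae_of_all _ fun w => log_refDensity_le_of_abs_le h0 h2 (by simp))
    (integrable_const _) (integrable_const (Real.log (refDensity α 0)))

theorem strengthExists_of_memLp_top [IsProbabilityMeasure P] (h0 : 0 < α) (h2 : α ≤ 2)
    (hY : MemLp Y ⊤ P) : StrengthExists α Y P := by
  have hlim : Tendsto (fun s : ℝ => -Real.log (refDensity α (lpNorm Y ⊤ P / s))) atTop
      (𝓝 (-Real.log (refDensity α 0))) :=
    (((continuous_log_refDensity h0 h2).tendsto 0).comp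
      (tendsto_const_nhds.div_atTop tendsto_id)).neg
  obtain ⟨s, hs, hs0⟩ := ((hlim.eventually_lt_const
    (neg_log_refDensity_zero_lt_refEntropy h0 h2)).and (eventually_gt_atTop 0)).exists
  have hsi := integrable_log_refDensity_div h0 h2 hY s
  refine ⟨s, hs0, hsi, (neg_le_neg ?_).trans hs.le⟩
  simpa using integral_mono_ae (integrable_const _) hsi (ae_log_refDensity_lpNorm_div_le h0 h2 hY s)

theorem tendsto_strength [IsProbabilityMeasure P] {Ω' ι : Type*} [MeasurableSpace Ω']
    {P' : Measure Ω'} [IsProbabilityMeasure P'] {l : Filter ι} {Z : ι → Ω → ℝ} {U : Ω' → ℝ}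
    (h0 : 0 < α) (h2 : α ≤ 2) (hZ : ∀ᶠ i in l, MemLp (Z i) ⊤ P) (hU : MemLp U ⊤ P')
    (hcost : ∀ t, 0 < t → Tendsto (fun i => ∫ w, Real.log (refDensity α (Z i w / t)) ∂P) l
      (𝓝 (∫ w, Real.log (refDensity α (U w / t)) ∂P'))) :
    Tendsto (fun i => strength α (Z i) P) l (𝓝 (strength α U P')) := by
  refine tendsto_order.2 ⟨fun a ha => ?_, fun b hb => ?_⟩
  · rcases lt_or_ge a 0 with ha0 | ha0
    · exact Eventually.of_forall fun i => ha0.trans_le (strength_nonneg α (Z i) P)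
    obtain ⟨t, hat, ht⟩ := exists_between ha
    have ht0 : 0 < t := ha0.trans_lt hat
    have hgt := refEntropy_lt_neg_integral_log_refDensity_div ht0
      (integrable_log_refDensity_div h0 h2 hU t) ht
    filter_upwards [(hcost t ht0).neg.eventually_const_lt hgt, hZ] with i hi hZi
    refine hat.trans_le ?_
    by_contra! hlt
    exact hi.not_ge (mem_strengthSet_of_strength_lt h0 h2 hZi.aemeasurable
      (strengthExists_of_memLp_top h0 h2 hZi) hlt).2.2
  · obtain ⟨t, ht, htb⟩ := exists_between hb
    have ht0 : 0 < t := (strength_nonneg α U P').trans_lt ht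
    have hlt := neg_integral_log_refDensity_div_lt_refEntropy h0 h2 hU.aemeasurable
      (strengthExists_of_memLp_top h0 h2 hU) ht
    filter_upwards [(hcost t ht0).neg.eventually_lt_const hlt, hZ] with i hi hZi
    exact (strength_le_of_mem_strengthSet
      ⟨ht0, integrable_log_refDensity_div h0 h2 hZi t, hi.le⟩).trans_lt htb

theorem refDensity_two (x : ℝ) : refDensity 2 x = gaussianPDFReal 0 1 x := by
  have hsqrt : (2 * Real.pi)⁻¹ * √(Real.pi / (1 / 2)) = (√(2 * Real.pi))⁻¹ := by
    rw [div_div_eq_mul_div, div_one, mul_comm Real.pi, inv_mul_eq_div, Real.sqrt_div_self]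
  rw [refDensity_eq two_pos]
  simp only [Real.rpow_two, sq_abs, cosTransform_gaussian one_half_pos, ← mul_assoc, hsqrt,
    gaussianPDFReal, NNReal.coe_one, mul_one, sub_zero]
  congr 2
  ring

theorem log_refDensity_two (x : ℝ) :
    Real.log (refDensity 2 x) = Real.log (refDensity 2 0) - x ^ 2 / 2 := by
  have hexp : refDensity 2 x = refDensity 2 0 * Real.exp (-(x ^ 2 / 2)) := by
    simp [refDensity_two, gaussianPDFReal, neg_div]
  rw [hexp, Real.log_mul (refDensity_pos two_pos le_rfl 0).ne' (Real.exp_pos _).ne', Real.log_exp,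
    sub_eq_add_neg]

theorem integral_refDensity_two_mul_sq : ∫ x, refDensity 2 x * x ^ 2 = 1 := by
  have hvar := variance_fun_id_gaussianReal (μ := 0) (v := 1)
  rw [variance_eq_integral measurable_id'.aemeasurable, integral_id_gaussianReal,
    integral_gaussianReal_eq_integral_smul one_ne_zero] at hvar
  simpa [refDensity_two] using hvar

theorem refEntropy_two : refEntropy 2 = 1 / 2 - Real.log (refDensity 2 0) := by
  have hsq : Integrable fun x => refDensity 2 x * x ^ 2 :=
    .of_integral_ne_zero (integral_refDensity_two_mul_sq ▸ one_ne_zero)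
  have hlog (x : ℝ) : refDensity 2 x * Real.log (refDensity 2 x) =
      refDensity 2 x * Real.log (refDensity 2 0) - refDensity 2 x * x ^ 2 / 2 := by
    rw [log_refDensity_two]
    ring
  simp only [refEntropy, hlog]
  rw [integral_sub ((integrable_refDensity two_pos le_rfl).mul_const _) (hsq.div_const 2),
    integral_mul_const, integral_div, integral_refDensity two_pos le_rfl,
    integral_refDensity_two_mul_sq]
  ring

theorem mem_strengthSet_two [IsProbabilityMeasure P] (hY : MemLp Y 2 P) :
    s ∈ strengthSet 2 Y P ↔ 0 < s ∧ √(∫ w, Y w ^ 2 ∂P) ≤ s := by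
  refine and_congr_right fun hs => ?_
  have hsq : Integrable (fun w => (Y w / s) ^ 2 / 2) P := by
    simpa only [div_pow] using (hY.integrable_sq.div_const (s ^ 2)).div_const 2
  have hcost : ∫ w, Real.log (refDensity 2 (Y w / s)) ∂P =
      Real.log (refDensity 2 0) - (∫ w, Y w ^ 2 ∂P) / s ^ 2 / 2 := by
    simp only [fun w => log_refDensity_two (Y w / s)]
    rw [integral_sub (integrable_const _) hsq]
    simp [div_pow, integral_div]
  have hint : Integrable (fun w => Real.log (refDensity 2 (Y w / s))) P := by
    simp only [fun w => log_refDensity_two (Y w / s)]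
    exact (integrable_const _).sub hsq
  rw [and_iff_right hint, hcost, refEntropy_two, Real.sqrt_le_left hs.le,
    ← div_le_one (by positivity : 0 < s ^ 2)]
  constructor <;> intro h <;> linarith

theorem strength_two [IsProbabilityMeasure P] (hY : MemLp Y 2 P) :
    strength 2 Y P = √(∫ w, Y w ^ 2 ∂P) := by
  refine csInf_eq_of_forall_ge_of_forall_gt_exists_lt
    ⟨√(∫ w, Y w ^ 2 ∂P) + 1, (mem_strengthSet_two hY).2 ⟨by positivity, by simp⟩⟩
    (fun s hs => ((mem_strengthSet_two hY).1 hs).2) fun t ht => ?_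
  obtain ⟨s, hs, hst⟩ := exists_between ht
  exact ⟨s, (mem_strengthSet_two hY).2 ⟨(Real.sqrt_nonneg _).trans_lt hs, hs.le⟩, hst⟩

end Strength

section QuantizationError

variable {Ω Ω' : Type*} [MeasurableSpace Ω] [MeasurableSpace Ω'] {P : Measure Ω} {P' : Measure Ω'}
  {X : Ω → ℝ} {U : Ω' → ℝ}

theorem memLp_top_of_isUniform_Ioo {a b : ℝ} (hab : a < b)
    (hU : pdf.IsUniform U (Set.Ioo a b) P' volume) : MemLp U ⊤ P' := by
  refine memLp_top_of_bound (aemeasurable_of_isUniform_Ioo hab hU).aestronglyMeasurable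
    (max (-a) b) ?_
  filter_upwards [ae_mem_Ioo_of_isUniform hab hU] with w hw
  exact abs_le'.2 ⟨hw.2.le.trans (le_max_right _ _), (neg_le_neg hw.1.le).trans (le_max_left _ _)⟩

theorem memLp_top_quantizationError (hX : AEMeasurable X P) {Δ : ℝ} (hΔ : 0 < Δ) :
    MemLp (fun w => (X w - uniformQuantizer Δ (X w)) / Δ) ⊤ P :=
  memLp_top_of_bound
    ((hX.sub ((measurable_uniformQuantizer Δ).comp_aemeasurable hX)).div_const Δ
      |>.aestronglyMeasurable) (1 / 2)
    (ae_of_all _ fun w => abs_le.2 (Set.Ioc_subset_Icc_self (quantizationError_mem_Ioc hΔ (X w))))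

theorem strengthExists_quantizationError [IsProbabilityMeasure P] {α : ℝ} (h0 : 0 < α)
    (h2 : α ≤ 2) (hX : AEMeasurable X P) {Δ : ℝ} (hΔ : 0 < Δ) :
    StrengthExists α (fun w => X w - uniformQuantizer Δ (X w)) P := by
  refine strengthExists_of_memLp_top h0 h2 ?_
  simpa only [div_mul_cancel₀ _ hΔ.ne'] using (memLp_top_quantizationError hX hΔ).mul_const Δ

theorem tendsto_integral_log_refDensity_quantizationError [IsProbabilityMeasure P]
    {α : ℝ} (h0 : 0 < α) (h2 : α ≤ 2) (hX : AEMeasurable X P)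
    (hXchar : Tendsto (charFun (P.map X)) (cocompact ℝ) (𝓝 0))
    (hU : pdf.IsUniform U (Set.Ioo (-(1 / 2 : ℝ)) (1 / 2)) P' volume) (t : ℝ) :
    Tendsto
      (fun Δ : ℝ => ∫ w, Real.log (refDensity α ((X w - uniformQuantizer Δ (X w)) / Δ / t)) ∂P)
      (𝓝[>] 0) (𝓝 (∫ w, Real.log (refDensity α (U w / t)) ∂P')) := by
  have := Measure.isProbabilityMeasure_map hX
  have hcont : Continuous fun x : ℝ => Real.log (refDensity α (x / t)) :=
    (continuous_log_refDensity h0 h2).comp (continuous_id.div_const t)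
  have hends : Real.log (refDensity α (-(1 / 2) / t)) = Real.log (refDensity α (1 / 2 / t)) := by
    rw [neg_div, (isGaussianMixtureLike_refDensity h0 h2).even]
  have hlimit : ∫ w, Real.log (refDensity α (U w / t)) ∂P' =
      ∫ x in (-(1 / 2 : ℝ))..(1 / 2), Real.log (refDensity α (x / t)) := by
    rw [integral_comp_of_isUniform_Ioo (by norm_num) hU hcont]
    norm_num
  rw [hlimit]
  refine (tendsto_integral_quantizationError hXchar hcont hends).congr fun Δ => ?_
  refine integral_map hX (Measurable.aestronglyMeasurable ?_)
  exact hcont.measurable.comp ((measurable_id.sub (measurable_uniformQuantizer Δ)).div_const Δ)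

theorem tendsto_strength_quantizationError_div [IsProbabilityMeasure P] [IsProbabilityMeasure P']
    {α : ℝ} (h0 : 0 < α) (h2 : α ≤ 2) (hX : AEMeasurable X P)
    (hXchar : Tendsto (charFun (P.map X)) (cocompact ℝ) (𝓝 0))
    (hU : pdf.IsUniform U (Set.Ioo (-(1 / 2 : ℝ)) (1 / 2)) P' volume) :
    Tendsto (fun Δ : ℝ => strength α (fun w => X w - uniformQuantizer Δ (X w)) P / Δ)
      (𝓝[>] 0) (𝓝 (strength α U P')) := by
  have herror : ∀ᶠ Δ in 𝓝[>] (0 : ℝ),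
      MemLp (fun w => (X w - uniformQuantizer Δ (X w)) / Δ) ⊤ P :=
    eventually_mem_nhdsWithin.mono fun Δ hΔ => memLp_top_quantizationError hX hΔ
  refine (tendsto_strength h0 h2 herror (memLp_top_of_isUniform_Ioo (by norm_num) hU) fun t _ =>
    tendsto_integral_log_refDensity_quantizationError h0 h2 hX hXchar hU t).congr' ?_
  filter_upwards [self_mem_nhdsWithin] with Δ hΔ
  exact strength_div_const hΔ

theorem strength_two_of_isUniform [IsProbabilityMeasure P']
    (hU : pdf.IsUniform U (Set.Ioo (-(1 / 2 : ℝ)) (1 / 2)) P' volume) :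
    strength 2 U P' = √(1 / 12) := by
  rw [strength_two ((memLp_top_of_isUniform_Ioo (by norm_num) hU).mono_exponent le_top),
    integral_comp_of_isUniform_Ioo (by norm_num) hU (continuous_pow 2), integral_pow]
  norm_num

end QuantizationError

theorem theorem3_general {Ω Ω' : Type*} [MeasurableSpace Ω] [MeasurableSpace Ω']
    (P : Measure Ω) [IsProbabilityMeasure P] (P' : Measure Ω') [IsProbabilityMeasure P']
    (α : ℝ) (hα0 : 0 < α) (hα2 : α ≤ 2) (X : Ω → ℝ) (hX : AEMeasurable X P)
    (hXchar : Tendsto (charFun (P.map X)) (cocompact ℝ) (𝓝 0))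
    (U : Ω' → ℝ) (hU : pdf.IsUniform U (Set.Ioo (-(1 / 2 : ℝ)) (1 / 2)) P' volume) :
    StrengthExists α U P' ∧
    (∀ Δ : ℝ, 0 < Δ → StrengthExists α (fun w => X w - uniformQuantizer Δ (X w)) P) ∧
    Tendsto (fun Δ : ℝ => strength α (fun w => X w - uniformQuantizer Δ (X w)) P / Δ)
      (𝓝[>] 0) (𝓝 (strength α U P')) ∧
    (α = 2 → strength α U P' = Real.sqrt (1 / 12)) :=
  ⟨strengthExists_of_memLp_top hα0 hα2 (memLp_top_of_isUniform_Ioo (by norm_num) hU),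
    fun _ hΔ => strengthExists_quantizationError hα0 hα2 hX hΔ,
    tendsto_strength_quantizationError_div hα0 hα2 hX hXchar hU,
    fun hα => hα ▸ strength_two_of_isUniform hU⟩

theorem theorem3 {Ω Ω' : Type*} [MeasurableSpace Ω] [MeasurableSpace Ω']
    (P : Measure Ω) [IsProbabilityMeasure P] (P' : Measure Ω') [IsProbabilityMeasure P']
    (α : ℝ) (hα0 : 0 < α) (hα2 : α ≤ 2)
    (X : Ω → ℝ) (hX : HasPDF X P volume) (hs : StrengthExists α X P)
    (U : Ω' → ℝ) (hU : pdf.IsUniform U (Set.Ioo (-(1 / 2 : ℝ)) (1 / 2)) P' volume) :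
    StrengthExists α U P' ∧
    (∀ Δ : ℝ, 0 < Δ → StrengthExists α (fun w => X w - uniformQuantizer Δ (X w)) P) ∧
    Tendsto (fun Δ : ℝ => strength α (fun w => X w - uniformQuantizer Δ (X w)) P / Δ)
      (𝓝[>] 0) (𝓝 (strength α U P')) ∧
    (α = 2 → strength α U P' = Real.sqrt (1 / 12)) :=
  theorem3_general P P' α hα0 hα2 X (HasPDF.aemeasurable X P volume)
    (tendsto_charFun_cocompact HasPDF.absolutelyContinuous) U hU
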